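/- Setting. Let $C\subseteq\mathbb R^n$ be a nonempty convex set, let $f:\mathbb R^n\to\mathbb R$ be continuously differentiable on $C$, let $A:\mathbb R^n\to\mathbb R^m$ be linear, and let $g:\mathbb R^m\to\mathbb R\cup\{+\infty\}$ be polyhedral convex (its epigraph is a finite intersection of closed half-spaces). Assume that there is $x\in\mathrm{ri}(C)$ with $Ax\in\mathrm{dom}\,g$. For $\beta>0$ put $$L_\beta(x,y,\lambda)=f(x)+\delta_C(x)+g(y)+\langle\lambda,Ax-y\rangle+\tfrac{\beta}{2}\|Ax-y\|^2,\qquad l_\beta(x,\lambda)=\min_{y}L_\beta(x,y,\lambda),$$ where $\delta_C$ is $0$ on $C$ and $+\infty$ off $C$. One ADMM step with parameter $\beta$ from $(y^k,\lambda^k)$ produces $(x^{k+1},y^{k+1},\lambda^{k+1})$ with $$x^{k+1}\in\operatorname*{argmin}_{x\in C}\ f(x)+\langle\lambda^k,Ax\rangle+\tfrac{\beta}{2}\|Ax-y^k\|^2,\qquad y^{k+1}\in\operatorname*{argmin}_{y}\ g(y)-\langle\lambda^k,y\rangle+\tfrac{\beta}{2}\|Ax^{k+1}-y\|^2,$$ $$\lambda^{k+1}=\lambda^k+\beta(Ax^{k+1}-y^{k+1}).$$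 Assumption on $(\bar x,\bar\lambda)$. Suppose that (i) $0\in\partial\delta_C(\bar x)+\nabla f(\bar x)+A^{\top}\bar\lambda$ and $\bar\lambda\in\partial g(A\bar x)$; (ii) $f$ is twice continuously differentiable in a neighborhood of $\bar x$, and $\nabla^2f(\bar x)$ is positive definite relative to the subspace $V_C\cap S_A$. Here $V_C=\mathrm{aff}(C)-x$ for any $x\in C$, $S$ is the smallest linear subspace containing $\{w\in\mathbb R^m : g'(A\bar x;w)=\langle\bar\lambda,w\rangle\}$ (with $g'$ the one-sided directional derivative), and $S_A=\{v\in\mathbb R^n : Av\in S\}$. Let $P=I-P_S$, where $P_S$ is the orthogonal projector onto $S$, and let $\beta_0>0$ be such that $\nabla^2f(\bar x)+\beta_0A^{\top}PA$ is positive definite relative to $V_C$. Put $\bar y=A\bar x$. Claim. For every $\beta\ge\beta_0$ there are arbitrarily small neighborhoods $\mathcal X_\beta\times\Lambda_\beta$ of $(\bar x,\bar\lambda)$ with the following property. Let $y^k\in\mathrm{dom}\,g$ and $\lambda^k\in\Lambda_\beta\cap\partial g(y^k)$, let $(x^{k+1},y^{k+1},\lambda^{k+1})$ be obtained from $(y^k,\lambda^k)$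 by one ADMM step with parameter $\beta$, and let $x^{k+1}\in\mathcal X_\beta$. Then for every $\lambda^*$ such that $(\bar x,\lambda^*)$ is a saddle point of $l_{\beta_0}$ relative to $\mathcal X_\beta\times\Lambda_\beta$ (minimum in $x$, maximum in $\lambda$), and for every $\theta\in[0,1]$, the values $l_{\beta_0}(x^{k+1},\lambda^*)$ and $l_{\beta_0}(\bar x,\lambda^*)$ are finite and $$\begin{aligned} &l_{\beta_0}(x^{k+1},\lambda^*)-l_{\beta_0}(\bar x,\lambda^*)+\frac{\theta\beta-\beta_0}{2}(x^{k+1}-\bar x)^{\top}A^{\top}PA(x^{k+1}-\bar x)\\ &\quad\le\frac{\beta}{2}\bigl(\|y^k-\bar y\|^2-\|y^{k+1}-\bar y\|^2\bigr)+\frac{1}{2\beta}\bigl(\|\lambda^k-\lambda^*\|^2-\|\lambda^{k+1}-\lambda^*\|^2\bigr)\\ &\qquad-\frac{\beta}{2}\|y^{k+1}-y^k\|^2-\frac{(1-\theta)\beta-\beta_0}{2\beta^2}\|\lambda^{k+1}-\lambda^k\|^2 . \end{aligned}$$ -/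

import Mathlib

open Set Filter Topology
open scoped Pointwise InnerProductSpace

noncomputable section

namespace CompositeADMM

/-- `ℝⁿ` with its Euclidean norm and inner product. -/
abbrev Vec (n : ℕ) : Type := EuclideanSpace ℝ (Fin n)

/-- The (convex-analysis) subdifferential of an extended-real-valued function. -/
def subdiff {d : ℕ} (φ : Vec d → EReal) (x : Vec d) : Set (Vec d) :=
  {v | ∀ z, φ x + ((⟪v, z - x⟫_ℝ : ℝ) : EReal) ≤ φ z}

/-- The indicator function `δ_C`: `0` on `C` and `+∞` off `C`. -/
def indicatorFn {d : ℕ} (C : Set (Vec d)) (x : Vec d) : EReal :=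
  open Classical in if x ∈ C then 0 else ⊤

/-- `φ : ℝᵈ → ℝ ∪ {+∞}` is polyhedral convex: it never takes the value `-∞`, and its epigraph is
the intersection of finitely many closed half-spaces of `ℝᵈ × ℝ`. -/
def IsPolyhedralConvex {d : ℕ} (φ : Vec d → EReal) : Prop :=
  (∀ y, φ y ≠ ⊥) ∧
    ∃ (N : ℕ) (a : Fin N → Vec d) (c b : Fin N → ℝ),
      ∀ (y : Vec d) (t : ℝ), φ y ≤ (t : EReal) ↔ ∀ i, ⟪a i, y⟫_ℝ + c i * t ≤ b i

/-- `φ'(x; w) = L`: the one-sided directional derivative of `φ` at `x` along `w` exists in the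
extended reals and equals `L`. -/
def HasDirDeriv {d : ℕ} (φ : Vec d → EReal) (x w : Vec d) (L : EReal) : Prop :=
  Tendsto (fun t : ℝ => (φ (x + t • w) - φ x) / (t : EReal)) (𝓝[>] 0) (𝓝 L)

/-- `T_φ(x ∣ v) = {w ∣ φ'(x; w) = ⟨v, w⟩}`. -/
def tangentSet {d : ℕ} (φ : Vec d → EReal) (x v : Vec d) : Set (Vec d) :=
  {w | HasDirDeriv φ x w ((⟪v, w⟫_ℝ : ℝ) : EReal)}

/-- `S(x ∣ v)`: the smallest linear subspace that contains `T_φ(x ∣ v)`. -/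
def tangentSpan {d : ℕ} (φ : Vec d → EReal) (x v : Vec d) : Submodule ℝ (Vec d) :=
  Submodule.span ℝ (tangentSet φ x v)

/-- `P = I - P_S`, with `P_S` the orthogonal projector onto `S = S(x ∣ v)`. -/
def normalProj {d : ℕ} (φ : Vec d → EReal) (x v : Vec d) : Vec d →L[ℝ] Vec d :=
  ContinuousLinearMap.id ℝ (Vec d) - (tangentSpan φ x v).starProjection

/-- `V_C = aff(C) - x` for any `x ∈ C`: the direction of the affine hull of `C`. -/
def hullDirection {d : ℕ} (C : Set (Vec d)) : Submodule ℝ (Vec d) :=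
  (affineSpan ℝ C).direction

/-- `S_A = {v ∣ A v ∈ S}`, with `S = S(x ∣ lam)` formed for `g`. -/
def preTangentSpan {n m : ℕ} (A : Vec n →L[ℝ] Vec m) (g : Vec m → EReal) (y lam : Vec m) :
    Submodule ℝ (Vec n) :=
  (tangentSpan g y lam).comap (A : Vec n →ₗ[ℝ] Vec m)

/-- The Hessian `∇²f(x)`, as a linear operator. -/
def hessian {n : ℕ} (f : Vec n → ℝ) (x : Vec n) : Vec n →L[ℝ] Vec n :=
  fderiv ℝ (gradient f) x

/-- The operator `H` is positive definite relative to the subspace `V`. -/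
def PosDefOn {n : ℕ} (H : Vec n →L[ℝ] Vec n) (V : Submodule ℝ (Vec n)) : Prop :=
  ∀ v ∈ V, v ≠ 0 → 0 < ⟪v, H v⟫_ℝ

/-- First-order optimality: `0 ∈ ∂δ_C(x) + ∇f(x) + Aᵀ lam` and `lam ∈ ∂g(A x)`. -/
def FirstOrder {n m : ℕ} (C : Set (Vec n)) (f : Vec n → ℝ) (g : Vec m → EReal)
    (A : Vec n →L[ℝ] Vec m) (x : Vec n) (lam : Vec m) : Prop :=
  (∃ v ∈ subdiff (indicatorFn C) x,
      v + gradient f x + ContinuousLinearMap.adjoint A lam = 0) ∧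
    lam ∈ subdiff g (A x)

/-- First-order optimality together with the second-order condition: `f` is twice continuously
differentiable near `x`, and `∇²f(x)` is positive definite relative to `V_C ∩ S_A`. -/
def LocalAssumption {n m : ℕ} (C : Set (Vec n)) (f : Vec n → ℝ) (g : Vec m → EReal)
    (A : Vec n →L[ℝ] Vec m) (x : Vec n) (lam : Vec m) : Prop :=
  FirstOrder C f g A x lam ∧
    (∃ U : Set (Vec n), IsOpen U ∧ x ∈ U ∧ ContDiffOn ℝ 2 f U) ∧
      PosDefOn (hessian f x) (hullDirection C ⊓ preTangentSpan A g (A x) lam)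

/-- The augmented Lagrangian
`L_β(x, y, lam) = f(x) + δ_C(x) + g(y) + ⟨lam, A x - y⟩ + (β/2) ‖A x - y‖²`. -/
def augLag {n m : ℕ} (C : Set (Vec n)) (f : Vec n → ℝ) (g : Vec m → EReal)
    (A : Vec n →L[ℝ] Vec m) (β : ℝ) (x : Vec n) (y lam : Vec m) : EReal :=
  (f x : EReal) + indicatorFn C x + g y
    + ((⟪lam, A x - y⟫_ℝ + β / 2 * ‖A x - y‖ ^ 2 : ℝ) : EReal)

/-- The reduced augmented Lagrangian `l_β(x, lam) = min_y L_β(x, y, lam)`. -/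
def redLag {n m : ℕ} (C : Set (Vec n)) (f : Vec n → ℝ) (g : Vec m → EReal)
    (A : Vec n →L[ℝ] Vec m) (β : ℝ) (x : Vec n) (lam : Vec m) : EReal :=
  ⨅ y : Vec m, augLag C f g A β x y lam

/-- `x'` minimizes `f(x) + ⟨lam, A x⟩ + (β/2) ‖A x - y‖²` over `x ∈ C`. -/
def IsXUpdate {n m : ℕ} (C : Set (Vec n)) (f : Vec n → ℝ) (A : Vec n →L[ℝ] Vec m) (β : ℝ)
    (y lam : Vec m) (x' : Vec n) : Prop :=
  x' ∈ C ∧ IsMinOn (fun x => f x + ⟪lam, A x⟫_ℝ + β / 2 * ‖A x - y‖ ^ 2) C x'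

/-- `y'` minimizes `g(y) + ⟨lam, -y⟩ + (β/2) ‖A x' - y‖²` over all `y`. -/
def IsYUpdate {n m : ℕ} (g : Vec m → EReal) (A : Vec n →L[ℝ] Vec m) (β : ℝ)
    (lam : Vec m) (x' : Vec n) (y' : Vec m) : Prop :=
  IsMinOn (fun y => g y + ((⟪lam, -y⟫_ℝ + β / 2 * ‖A x' - y‖ ^ 2 : ℝ) : EReal)) univ y'

/-- `(x', y', lam')` is obtained from `(y, lam)` by one ADMM step with penalty parameter `β`. -/
def IsADMMStep {n m : ℕ} (C : Set (Vec n)) (f : Vec n → ℝ) (g : Vec m → EReal)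
    (A : Vec n →L[ℝ] Vec m) (β : ℝ) (y lam : Vec m) (x' : Vec n) (y' lam' : Vec m) : Prop :=
  IsXUpdate C f A β y lam x' ∧ IsYUpdate g A β lam x' y' ∧ lam' = lam + β • (A x' - y')

/-- `(a, b)` is a saddle point of `l` relative to `X × Λ`: `(a, b) ∈ X × Λ`, and
`l a lam ≤ l a b ≤ l x b` for all `x ∈ X` and `lam ∈ Λ`. -/
def IsSaddleRel {n m : ℕ} (l : Vec n → Vec m → EReal) (X : Set (Vec n)) (Λ : Set (Vec m))
    (a : Vec n) (b : Vec m) : Prop :=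
  a ∈ X ∧ b ∈ Λ ∧ IsSaddlePointOn X Λ l a b

end CompositeADMM

end

/-! The saddle property, tested only against `lbar`, forces `lstar` to be a subgradient of `g` at `A
xbar`, so `l_{β₀}(xbar, lstar) = f xbar + g (A xbar)`; inserting `y'` in the minimum bounds
`l_{β₀}(x', lstar)` from above. The difference is estimated by the variational inequality of the
`x`-step, the subgradient inequality at `y'`, monotonicity of `∂g` between `y` and `y'`, and a
tangent inequality for the nonconvex `f` with error `(β₀/2) q`, where `q = ‖P A (x' - xbar)‖²`
(`eventually_le_inner_gradient`). Polyhedrality controls `q`: the new multiplier is near `lbar`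
(`norm_multiplier_sub_le`), hence `lbar` is itself a subgradient at `y'`
(`IsPolyhedralConvex.eventually_subdiff`). Then `y' - A xbar` lies in `S`, `P` kills it, and `q ≤ ‖A
x' - y'‖²`. -/

namespace CompositeADMM

variable {d n m : ℕ}

/-! ### Subgradients of polyhedral convex functions. -/

lemma IsPolyhedralConvex.exists_coe {g : Vec d → EReal} (hg : IsPolyhedralConvex g) {y : Vec d}
    (hy : g y ≠ ⊤) : ∃ t : ℝ, g y = t :=
  ⟨(g y).toReal, (EReal.coe_toReal hy (hg.1 y)).symm⟩

/-- Subgradients at a point of finite value are tested on the effective domain only. -/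
lemma mem_subdiff_iff {g : Vec d → EReal} (hg : IsPolyhedralConvex g) {y v : Vec d} {t : ℝ}
    (hy : g y = t) :
    v ∈ subdiff g y ↔ ∀ (z : Vec d) (s : ℝ), g z = s → t + ⟪v, z - y⟫_ℝ ≤ s := by
  constructor
  · intro h z s hz
    have := h z
    rw [hy, hz] at this
    exact_mod_cast this
  · intro h z
    by_cases hz : g z = ⊤
    · rw [hz]; exact le_top
    · obtain ⟨s, hs⟩ := hg.exists_coe hz
      rw [hy, hs]
      exact_mod_cast h z s hs

lemma subdiff_ne_top {g : Vec d → EReal} {y v z : Vec d} (h : v ∈ subdiff g y) (hz : g z ≠ ⊤) :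
    g y ≠ ⊤ := by
  intro hy
  have := h z
  rw [hy, EReal.top_add_coe, top_le_iff] at this
  exact hz this

lemma IsPolyhedralConvex.le_combo {g : Vec d → EReal} (hg : IsPolyhedralConvex g) {y z : Vec d}
    {t s τ : ℝ} (hy : g y = t) (hz : g z = s) (h0 : 0 ≤ τ) (h1 : τ ≤ 1) :
    g (y + τ • (z - y)) ≤ ((t + τ * (s - t) : ℝ) : EReal) := by
  obtain ⟨-, N, a, c, b, h⟩ := hg
  rw [h]
  intro i
  have e1 := (h y t).1 hy.le i
  have e2 := (h z s).1 hz.le i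
  rw [inner_add_right, inner_smul_right, inner_sub_right]
  nlinarith [mul_le_mul_of_nonneg_left e2 h0, mul_le_mul_of_nonneg_left e1 (sub_nonneg.2 h1)]

/-- A subgradient inequality with a quadratic error is an exact one. -/
lemma mem_subdiff_of_quadratic {g : Vec d → EReal} (hg : IsPolyhedralConvex g) {y v : Vec d}
    {t c : ℝ} (hy : g y = t)
    (h : ∀ (z : Vec d) (s : ℝ), g z = s → t + ⟪v, z - y⟫_ℝ ≤ s + c * ‖z - y‖ ^ 2) :
    v ∈ subdiff g y := by
  rw [mem_subdiff_iff hg hy]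
  intro z s hz
  -- At the point `y + τ • (z - y)` the error is of order `τ²` and the linear terms of order `τ`;
  -- dividing by `τ` leaves an error that vanishes as `τ → 0`.
  have key : ∀ τ ∈ Ioc (0 : ℝ) 1, t + ⟪v, z - y⟫_ℝ - s ≤ c * ‖z - y‖ ^ 2 * τ := by
    rintro τ ⟨h0, h1⟩
    have hc := hg.le_combo hy hz h0.le h1
    obtain ⟨u, hu⟩ := hg.exists_coe (ne_top_of_le_ne_top (EReal.coe_ne_top _) hc)
    rw [hu, EReal.coe_le_coe_iff] at hc
    have := h _ u hu
    rw [add_sub_cancel_left, inner_smul_right, norm_smul, mul_pow, Real.norm_eq_abs, sq_abs] at this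
    have h2 : τ * (t + ⟪v, z - y⟫_ℝ - s) ≤ τ * (c * ‖z - y‖ ^ 2 * τ) := by nlinarith
    exact le_of_mul_le_mul_left h2 h0
  have hlim : Tendsto (fun τ : ℝ => c * ‖z - y‖ ^ 2 * τ) (𝓝[>] 0) (𝓝 0) := by
    have : Tendsto (fun τ : ℝ => c * ‖z - y‖ ^ 2 * τ) (𝓝 0) (𝓝 (c * ‖z - y‖ ^ 2 * 0)) :=
      tendsto_id.const_mul _
    rw [mul_zero] at this
    exact this.mono_left nhdsWithin_le_nhds
  have := ge_of_tendsto hlim (b := t + ⟪v, z - y⟫_ℝ - s)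
    (by filter_upwards [Ioc_mem_nhdsGT one_pos] with τ hτ using key τ hτ)
  linarith

lemma subdiff_monotone {g : Vec d → EReal} (hg : IsPolyhedralConvex g) {y z v w : Vec d} {t s : ℝ}
    (hy : g y = t) (hz : g z = s) (hv : v ∈ subdiff g y) (hw : w ∈ subdiff g z) :
    0 ≤ ⟪v - w, y - z⟫_ℝ := by
  have h1 := (mem_subdiff_iff hg hy).1 hv z s hz
  have h2 := (mem_subdiff_iff hg hz).1 hw y t hy
  rw [inner_sub_right] at h1 h2
  simp only [inner_sub_left, inner_sub_right]
  linarith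

/-- For a polyhedral convex function, the points at which a slope near `v` is a subgradient also
have `v` as a subgradient. -/
lemma IsPolyhedralConvex.eventually_subdiff {g : Vec d → EReal} (hg : IsPolyhedralConvex g)
    (v : Vec d) :
    ∀ᶠ w in 𝓝 v, ∀ (y : Vec d) (t : ℝ), g y = t → w ∈ subdiff g y → v ∈ subdiff g y := by
  obtain ⟨N, a, c, b, h⟩ := hg.2
  -- At a point of the graph with active constraints `I`, the subdifferential is exactly `M I`.
  -- There are finitely many such closed sets, so a slope close enough to `v` avoids every one that
  -- misses `v`.
  let M : Finset (Fin N) → Set (Vec d) := fun I =>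
    {u | ∀ (p : Vec d) (s : ℝ), (∀ i ∈ I, ⟪a i, p⟫_ℝ + c i * s ≤ 0) → ⟪u, p⟫_ℝ ≤ s}
  have hclosed : ∀ I, IsClosed (M I) := by
    intro I
    simp only [M, ofPred_forall]
    refine isClosed_iInter fun p => isClosed_iInter fun s => isClosed_iInter fun _ => ?_
    exact isClosed_le (by fun_prop) continuous_const
  have hev : ∀ᶠ w in 𝓝 v, ∀ I, w ∈ M I → v ∈ M I := by
    rw [eventually_all]
    intro I
    by_cases hv : v ∈ M I
    · exact Eventually.of_forall fun _ _ => hv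
    · filter_upwards [(hclosed I).isOpen_compl.mem_nhds hv] with w hw hw'
      exact absurd hw' hw
  filter_upwards [hev] with w hw y t hy hwy
  let I : Finset (Fin N) := Finset.univ.filter fun i => ⟪a i, y⟫_ℝ + c i * t = b i
  have hyt := (h y t).1 hy.le
  have hwM : w ∈ M I := by
    intro p s hps
    -- A direction allowed by the active constraints stays in the epigraph for small `τ`, since the
    -- inactive ones have slack.
    have hτ : ∀ᶠ τ in 𝓝[>] (0 : ℝ), ∀ i, ⟪a i, y + τ • p⟫_ℝ + c i * (t + τ * s) ≤ b i := by
      rw [eventually_all]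
      intro i
      by_cases hi : i ∈ I
      · filter_upwards [self_mem_nhdsWithin] with τ (hτ : 0 < τ)
        rw [inner_add_right, inner_smul_right]
        nlinarith [mul_nonpos_of_nonneg_of_nonpos hτ.le (hps i hi), hyt i]
      · have hlt : ⟪a i, y⟫_ℝ + c i * t < b i :=
          lt_of_le_of_ne (hyt i) fun e => hi (by simp [I, e])
        have hcont : Continuous fun τ : ℝ => ⟪a i, y + τ • p⟫_ℝ + c i * (t + τ * s) := by fun_prop
        have := hcont.continuousAt.eventually_lt (x₀ := 0)
          (continuousAt_const (y := b i)) (by simpa using hlt)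
        filter_upwards [this.filter_mono nhdsWithin_le_nhds] with τ hτ using hτ.le
    obtain ⟨τ, hτ, hτ0⟩ := (hτ.and self_mem_nhdsWithin).exists
    have hτ0 : 0 < τ := hτ0
    have h1 := (hwy (y + τ • p)).trans ((h _ _).2 hτ)
    rw [hy, add_sub_cancel_left, inner_smul_right, ← EReal.coe_add, EReal.coe_le_coe_iff] at h1
    exact le_of_mul_le_mul_left (by linarith) hτ0
  rw [mem_subdiff_iff hg hy]
  intro z s hz
  have := hw I hwM (z - y) (s - t) (by
    intro i hi
    have h1 := (h z s).1 hz.le i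
    have h2 : ⟪a i, y⟫_ℝ + c i * t = b i := by simpa [I] using hi
    rw [inner_sub_right]
    linarith)
  linarith

/-- The two subgradient inequalities with the common slope `v`, together with convexity, make `g`
affine of slope `v` on the segment from `y` to `z`, so the difference quotient is constant for `τ ≤
1`. -/
lemma sub_mem_tangentSet {g : Vec d → EReal} (hg : IsPolyhedralConvex g) {y z v : Vec d}
    {t s : ℝ} (hy : g y = t) (hz : g z = s) (hvy : v ∈ subdiff g y) (hvz : v ∈ subdiff g z) :
    z - y ∈ tangentSet g y v := by
  have h1 := (mem_subdiff_iff hg hz).1 hvz y t hy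
  refine Tendsto.congr' ?_ tendsto_const_nhds
  filter_upwards [Ioc_mem_nhdsGT (zero_lt_one (α := ℝ))] with τ ⟨h0, h1'⟩
  have hc := hg.le_combo hy hz h0.le h1'
  obtain ⟨u, hu⟩ := hg.exists_coe (ne_top_of_le_ne_top (EReal.coe_ne_top _) hc)
  have h2 := (mem_subdiff_iff hg hy).1 hvy _ u hu
  rw [hu, EReal.coe_le_coe_iff] at hc
  rw [add_sub_cancel_left, inner_smul_right] at h2
  rw [hu, hy, ← EReal.coe_sub, ← EReal.coe_div, EReal.coe_eq_coe_iff, eq_div_iff h0.ne']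
  rw [inner_sub_right] at h1 h2 ⊢
  nlinarith [mul_le_mul_of_nonneg_left h1 h0.le]

/-! ### The projector onto the orthogonal complement of `S`. -/

lemma norm_normalProj_le (g : Vec d → EReal) (y v w : Vec d) :
    ‖normalProj g y v w‖ ≤ ‖w‖ := by
  have : normalProj g y v = (tangentSpan g y v)ᗮ.starProjection := by
    rw [normalProj, Submodule.starProjection_orthogonal]
  rw [this]
  exact Submodule.norm_starProjection_apply_le _ _

lemma inner_normalProj_self (g : Vec d → EReal) (y v w : Vec d) :
    ⟪w, normalProj g y v w⟫_ℝ = ‖normalProj g y v w‖ ^ 2 := by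
  have : normalProj g y v = (tangentSpan g y v)ᗮ.starProjection := by
    rw [normalProj, Submodule.starProjection_orthogonal]
  rw [this, ← real_inner_self_eq_norm_sq, Submodule.inner_starProjection_left_eq_right,
    Submodule.starProjection_eq_self_iff.2 (Submodule.starProjection_apply_mem _ _)]

lemma normalProj_eq_zero {g : Vec d → EReal} {y v w : Vec d} (hw : w ∈ tangentSet g y v) :
    normalProj g y v w = 0 := by
  have : (tangentSpan g y v).starProjection w = w :=
    Submodule.starProjection_eq_self_iff.2 (Submodule.subset_span hw)
  simp [normalProj, this]

lemma indicatorFn_of_mem {C : Set (Vec d)} {x : Vec d} (hx : x ∈ C) : indicatorFn C x = 0 := by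
  simp [indicatorFn, hx]

/-! ### Bounds for the reduced augmented Lagrangian. -/

section RedLag

variable {C : Set (Vec n)} {f : Vec n → ℝ} {g : Vec m → EReal} {A : Vec n →L[ℝ] Vec m} {β : ℝ}
  {x : Vec n} {y v : Vec m} {t : ℝ}

lemma augLag_eq_coe (hx : x ∈ C) (hy : g y = t) (β : ℝ) (v : Vec m) :
    augLag C f g A β x y v
      = ((f x + t + (⟪v, A x - y⟫_ℝ + β / 2 * ‖A x - y‖ ^ 2) : ℝ) : EReal) := by
  rw [augLag, indicatorFn_of_mem hx, hy, add_zero]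
  norm_cast

lemma redLag_le (hx : x ∈ C) (hy : g y = t) (β : ℝ) (v : Vec m) :
    redLag C f g A β x v
      ≤ ((f x + t + (⟪v, A x - y⟫_ℝ + β / 2 * ‖A x - y‖ ^ 2) : ℝ) : EReal) :=
  (iInf_le _ y).trans_eq (augLag_eq_coe hx hy β v)

lemma le_redLag (hg : IsPolyhedralConvex g) (hβ : 0 ≤ β) (hx : x ∈ C) (hy : g y = t)
    (hv : v ∈ subdiff g y) :
    ((f x + t + ⟪v, A x - y⟫_ℝ : ℝ) : EReal) ≤ redLag C f g A β x v := by
  refine le_iInf fun z => ?_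
  by_cases hz : g z = ⊤
  · rw [augLag, indicatorFn_of_mem hx, hz, add_zero, EReal.coe_add_top, EReal.top_add_coe]
    exact le_top
  · obtain ⟨s, hs⟩ := hg.exists_coe hz
    rw [augLag_eq_coe hx hs, EReal.coe_le_coe_iff]
    have := (mem_subdiff_iff hg hy).1 hv z s hs
    have h2 : 0 ≤ β / 2 * ‖A x - z‖ ^ 2 := by positivity
    simp only [inner_sub_right] at this ⊢
    linarith

/-- If `x ∈ C` and `A x ∈ dom g`, then `f x + g (A x)` is the largest value of `l_β(x, ·)`, and only
subgradients of `g` at `A x` attain it. -/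
lemma mem_subdiff_of_le_redLag (hg : IsPolyhedralConvex g) (hx : x ∈ C) (hy : g (A x) = t)
    (h : ((f x + t : ℝ) : EReal) ≤ redLag C f g A β x v) : v ∈ subdiff g (A x) := by
  refine mem_subdiff_of_quadratic hg (c := β / 2) hy fun z s hz => ?_
  have := h.trans (redLag_le hx hz β v)
  rw [EReal.coe_le_coe_iff, norm_sub_rev] at this
  simp only [inner_sub_right] at this ⊢
  linarith

end RedLag

/-! ### Optimality conditions of the ADMM updates. -/

/-- The multiplier update produces a subgradient of `g` at the new `y`. -/
lemma IsYUpdate.mem_subdiff {g : Vec m → EReal} (hg : IsPolyhedralConvex g)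
    {A : Vec n →L[ℝ] Vec m} {β : ℝ} {lam : Vec m} {x' : Vec n} {y' : Vec m}
    (h : IsYUpdate g A β lam x' y') (hne : ∃ z, g z ≠ ⊤) :
    g y' ≠ ⊤ ∧ lam + β • (A x' - y') ∈ subdiff g y' := by
  have hmin : ∀ (z : Vec m) (s : ℝ), g z = s →
      g y' + ((⟪lam, -y'⟫_ℝ + β / 2 * ‖A x' - y'‖ ^ 2 : ℝ) : EReal)
        ≤ ((s + (⟪lam, -z⟫_ℝ + β / 2 * ‖A x' - z‖ ^ 2) : ℝ) : EReal) := by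
    intro z s hz
    have := h (mem_univ z)
    simp only [mem_ofPred_eq, hz] at this
    exact_mod_cast this
  have htop : g y' ≠ ⊤ := by
    obtain ⟨z, hz⟩ := hne
    obtain ⟨s, hs⟩ := hg.exists_coe hz
    intro htop
    have := hmin z s hs
    rw [htop, EReal.top_add_coe, top_le_iff] at this
    exact EReal.coe_ne_top _ this
  refine ⟨htop, ?_⟩
  obtain ⟨t, ht⟩ := hg.exists_coe htop
  refine mem_subdiff_of_quadratic hg (c := β / 2) ht fun z s hz => ?_
  have h1 := hmin z s hz
  rw [ht, ← EReal.coe_add, EReal.coe_le_coe_iff] at h1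
  have h2 : ‖A x' - z‖ ^ 2 = ‖A x' - y'‖ ^ 2 - 2 * ⟪A x' - y', z - y'⟫_ℝ + ‖z - y'‖ ^ 2 := by
    rw [← norm_sub_sq_real]
    congr 2
    abel
  rw [h2, inner_neg_right, inner_neg_right] at h1
  rw [inner_add_left, inner_smul_left, inner_sub_right lam]
  simp only [conj_trivial]
  linarith

lemma hasFDerivAt_inner_gradient {f : Vec n → ℝ} {x : Vec n} (h : DifferentiableAt ℝ f x) :
    HasFDerivAt f (innerSL ℝ (gradient f x)) x :=
  h.hasGradientAt.hasFDerivAt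

/-- The variational inequality for the `x`-update. -/
lemma IsXUpdate.inner_nonneg {C : Set (Vec n)} (hC : Convex ℝ C) {f : Vec n → ℝ}
    {A : Vec n →L[ℝ] Vec m} {β : ℝ} {y lam : Vec m} {x' z : Vec n}
    (h : IsXUpdate C f A β y lam x') (hf : DifferentiableAt ℝ f x') (hz : z ∈ C) :
    0 ≤ ⟪gradient f x', z - x'⟫_ℝ + ⟪lam + β • (A x' - y), A (z - x')⟫_ℝ := by
  have hd : HasFDerivAt (fun x => f x + ⟪lam, A x⟫_ℝ + β / 2 * ‖A x - y‖ ^ 2)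
      (innerSL ℝ (gradient f x') + (innerSL ℝ lam).comp A
        + (β / 2) • (2 • (innerSL ℝ (A x' - y)).comp A)) x' := by
    refine ((hasFDerivAt_inner_gradient hf).add ((innerSL ℝ lam).comp A).hasFDerivAt).add ?_
    exact ((A.hasFDerivAt.sub_const y).norm_sq).const_mul _
  have hpos := IsLocalMinOn.hasFDerivWithinAt_nonneg h.2.localize hd.hasFDerivWithinAt
    (sub_mem_posTangentConeAt_of_segment_subset (hC.segment_subset h.1 hz))
  simp only [add_apply, smul_apply, ContinuousLinearMap.comp_apply, innerSL_apply_apply,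
    smul_eq_mul, nsmul_eq_mul] at hpos
  rw [inner_add_left, inner_smul_left]
  simp only [conj_trivial]
  push_cast at hpos
  linarith

/-! ### Second-order analysis of `f`. -/

/-- A form that is positive on a subspace is coercive there. -/
lemma PosDefOn.exists_coercive {H : Vec n →L[ℝ] Vec n} {V : Submodule ℝ (Vec n)}
    (h : PosDefOn H V) : ∃ c > 0, ∀ v ∈ V, c * ‖v‖ ^ 2 ≤ ⟪v, H v⟫_ℝ := by
  have hK : IsCompact (Metric.sphere (0 : Vec n) 1 ∩ V) :=
    (isCompact_sphere _ _).inter_right V.closed_of_finiteDimensional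
  -- The sphere misses `V` only when `V` is trivial; otherwise the constant is the minimum of the
  -- form on the unit sphere of `V`.
  rcases (Metric.sphere (0 : Vec n) 1 ∩ V).eq_empty_or_nonempty with he | hne
  · refine ⟨1, one_pos, fun v hv => ?_⟩
    have : v = 0 := by
      by_contra hv0
      have : ‖v‖⁻¹ • v ∈ Metric.sphere (0 : Vec n) 1 ∩ V :=
        ⟨by simp [norm_smul, hv0], V.smul_mem _ hv⟩
      rw [he] at this
      exact this
    simp [this]
  · obtain ⟨u, ⟨hu1, huV⟩, hu⟩ := hK.exists_isMinOn hne
      (f := fun v => ⟪v, H v⟫_ℝ) (by fun_prop)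
    have hu0 : u ≠ 0 := by
      rintro rfl
      simp at hu1
    refine ⟨⟪u, H u⟫_ℝ, h u huV hu0, fun v hv => ?_⟩
    by_cases hv0 : v = 0
    · simp [hv0]
    · have hvn : 0 < ‖v‖ := norm_pos_iff.2 hv0
      have h1 : ⟪u, H u⟫_ℝ ≤ ⟪‖v‖⁻¹ • v, H (‖v‖⁻¹ • v)⟫_ℝ :=
        hu ⟨by simp [norm_smul, hv0], V.smul_mem _ hv⟩
      rw [map_smul, inner_smul_left, inner_smul_right, conj_trivial] at h1
      calc ⟪u, H u⟫_ℝ * ‖v‖ ^ 2 ≤ ‖v‖⁻¹ * (‖v‖⁻¹ * ⟪v, H v⟫_ℝ) * ‖v‖ ^ 2 := by gcongr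
        _ = ⟪v, H v⟫_ℝ := by field_simp

/-- If `∇²f(xbar) + B` is positive definite relative to `V`, then near `xbar` and along `V` the
function `f + ½⟨· - xbar, B(· - xbar)⟩` lies above its tangents. -/
lemma eventually_le_inner_gradient {f : Vec n → ℝ} {xbar : Vec n} (hf : ContDiffAt ℝ 2 f xbar)
    {B : Vec n →L[ℝ] Vec n} {V : Submodule ℝ (Vec n)}  (hpos : PosDefOn (hessian f xbar + B) V) :
    ∀ᶠ x in 𝓝 xbar, x - xbar ∈ V →
      f x - f xbar ≤ ⟪gradient f x, x - xbar⟫_ℝ + 1 / 2 * ⟪x - xbar, B (x - xbar)⟫_ℝ := by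
  obtain ⟨c, hc, hcoer⟩ := hpos.exists_coercive
  have hgrad : ContDiffAt ℝ 1 (gradient f) xbar :=
    ((InnerProductSpace.toDual ℝ (Vec n)).symm.contDiff.contDiffAt).comp xbar
      (hf.fderiv_right (m := 1) (by norm_num))
  have hstrict : HasStrictFDerivAt (gradient f) (hessian f xbar) xbar :=
    hgrad.hasStrictFDerivAt (by norm_num)
  -- The coercivity constant `c` is the tolerance. Strict differentiability is needed because two
  -- moving points, `x` and `xbar + ξ • e`, are compared.
  have happrox := hstrict.isLittleO.def hc
  have hdiff : ∀ᶠ x in 𝓝 xbar, DifferentiableAt ℝ f x := by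
    filter_upwards [hf.eventually (by simp)] with x hx using hx.differentiableAt (by norm_num)
  obtain ⟨δ, hδ, hball⟩ := Metric.eventually_nhds_iff_ball.1 happrox
  obtain ⟨ρ, hρ, hdiff⟩ := Metric.eventually_nhds_iff_ball.1 hdiff
  filter_upwards [Metric.ball_mem_nhds xbar (lt_min hδ hρ)] with x hx hxV
  set e := x - xbar with he
  have hmem : ∀ τ ∈ Icc (0 : ℝ) 1, xbar + τ • e ∈ Metric.ball xbar (min δ ρ) := by
    rintro τ ⟨h0, h1⟩
    rw [mem_ball_iff_norm] at hx ⊢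
    rw [add_sub_cancel_left, norm_smul, Real.norm_of_nonneg h0]
    exact (mul_le_of_le_one_left (norm_nonneg _) h1).trans_lt hx
  have hderiv : ∀ τ ∈ Icc (0 : ℝ) 1,
      HasDerivAt (fun τ : ℝ => f (xbar + τ • e) + 1 / 2 * ⟪e, B e⟫_ℝ * τ ^ 2)
        (⟪gradient f (xbar + τ • e), e⟫_ℝ + τ * ⟪e, B e⟫_ℝ) τ := by
    intro τ hτ
    have h1 := hasFDerivAt_inner_gradient
      (hdiff _ (Metric.ball_subset_ball (min_le_right _ _) (hmem τ hτ)))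
    have h2 : HasDerivAt (fun τ : ℝ => xbar + τ • e) e τ := by
      simpa using ((hasDerivAt_id τ).smul_const e).const_add xbar
    have h3 := (h1.comp_hasDerivAt τ h2).add
      (((hasDerivAt_id τ).pow 2).const_mul (1 / 2 * ⟪e, B e⟫_ℝ))
    refine h3.congr_deriv ?_
    simp only [innerSL_apply_apply, id]
    ring
  obtain ⟨ξ, ⟨h0, h1⟩, hξ⟩ := exists_hasDerivAt_eq_slope _ _ one_pos
    (fun τ hτ => (hderiv τ hτ).continuousAt.continuousWithinAt)
    (fun τ hτ => hderiv τ (Ioo_subset_Icc_self hτ))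
  have hx1 : xbar + e = x := by rw [he, add_sub_cancel]
  simp only [one_smul, zero_smul, add_zero, hx1] at hξ
  have hb := hball (x, xbar + ξ • e) (by
    rw [← ball_prod_same]
    refine ⟨Metric.ball_subset_ball (min_le_left _ _) hx,
      Metric.ball_subset_ball (min_le_left _ _) (hmem ξ ⟨h0.le, h1.le⟩)⟩)
  have hsub : x - (xbar + ξ • e) = (1 - ξ) • e := by
    rw [sub_smul, one_smul, he]
    abel
  simp only [hsub, map_smul, norm_smul, Real.norm_of_nonneg (sub_nonneg.2 h1.le)] at hb
  have hb2 := (abs_le.1 ((abs_real_inner_le_norm _ e).trans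
    (mul_le_mul_of_nonneg_right hb (norm_nonneg e)))).1
  -- The gradient increment from `xbar + ξ • e` to `x`, paired with `e`, is at least `(1 - ξ) * (⟪H
  -- e, e⟫ - c * ‖e‖²)`, with `H` the Hessian at `xbar`; coercivity bounds this below by `-(1 - ξ) *
  -- ⟪e, B e⟫`.
  rw [inner_sub_left, inner_sub_left, inner_smul_left, conj_trivial] at hb2
  have hco := hcoer e hxV
  rw [add_apply, inner_add_right, real_inner_comm] at hco
  have := mul_le_mul_of_nonneg_left hco (sub_nonneg.2 h1.le)
  linarith

/-- The multiplier produced by the `y`-update is close to `lbar` if `lam` is, and `x'` is close to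
`xbar`. -/
lemma norm_multiplier_sub_le {g : Vec m → EReal} (hg : IsPolyhedralConvex g) {β t s : ℝ}
    (hβ : 0 ≤ β) {p y ybar lam lbar : Vec m} (hy : g y = t) (hybar : g ybar = s)
    (h : lam + β • (p - y) ∈ subdiff g y) (hbar : lbar ∈ subdiff g ybar) :
    ‖lam + β • (p - y) - lbar‖ ≤ β * ‖p - ybar‖ + ‖lam - lbar‖ := by
  have hmono := mul_nonneg hβ (subdiff_monotone hg hy hybar h hbar)
  set w := lam + β • (p - y) - lbar with hw
  -- Pairing this identity with `w` makes the last term nonnegative by monotonicity, so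
  -- Cauchy–Schwarz bounds `‖w‖`.
  have hdec : β • (p - ybar) + (lam - lbar) = w + β • (y - ybar) := by
    rw [hw]
    module
  have h1 : ‖w‖ ^ 2 ≤ ⟪w, β • (p - ybar) + (lam - lbar)⟫_ℝ := by
    rw [hdec, inner_add_right, inner_smul_right, real_inner_self_eq_norm_sq]
    linarith
  have h2 : ‖β • (p - ybar) + (lam - lbar)‖ ≤ β * ‖p - ybar‖ + ‖lam - lbar‖ := by
    refine (norm_add_le _ _).trans_eq ?_
    rw [norm_smul, Real.norm_of_nonneg hβ]
  refine le_trans ?_ h2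
  rcases (norm_nonneg w).eq_or_lt' with h0 | h0
  · rw [h0]; exact norm_nonneg _
  · refine le_of_mul_le_mul_left ?_ h0
    rw [← sq]
    exact h1.trans (real_inner_le_norm _ _)

end CompositeADMM

/-! ### The one-step estimate. -/

theorem mainTheorem3 {n m : ℕ}
    (C : Set (CompositeADMM.Vec n)) (f : CompositeADMM.Vec n → ℝ)
    (g : CompositeADMM.Vec m → EReal) (A : CompositeADMM.Vec n →L[ℝ] CompositeADMM.Vec m)
    (hCne : C.Nonempty) (hC : Convex ℝ C) (hf : ContDiffOn ℝ 1 f C)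
    (hg : CompositeADMM.IsPolyhedralConvex g)
    (hdom : ∃ x ∈ intrinsicInterior ℝ C, g (A x) ≠ ⊤)
    (xbar : CompositeADMM.Vec n) (lbar : CompositeADMM.Vec m)
    (hassum : CompositeADMM.LocalAssumption C f g A xbar lbar)
    (P : CompositeADMM.Vec m →L[ℝ] CompositeADMM.Vec m)
    (hP : P = CompositeADMM.normalProj g (A xbar) lbar)
    (β₀ : ℝ) (hβ₀ : 0 < β₀)
    (hpos : CompositeADMM.PosDefOn
      (CompositeADMM.hessian f xbar + β₀ • (ContinuousLinearMap.adjoint A ∘L P ∘L A))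
      (CompositeADMM.hullDirection C))
    (β : ℝ) (hβ : β₀ ≤ β) :
    -- the neighborhoods `X` of `xbar` and `Λ` of `lbar` can be chosen arbitrarily small
    ∀ U ∈ 𝓝 xbar, ∀ W ∈ 𝓝 lbar,
      ∃ X ∈ 𝓝 xbar, X ⊆ U ∧ ∃ Λ ∈ 𝓝 lbar, Λ ⊆ W ∧
        ∀ (y lam : CompositeADMM.Vec m) (x' : CompositeADMM.Vec n)
          (y' lam' : CompositeADMM.Vec m),
          g y ≠ ⊤ → lam ∈ Λ → lam ∈ CompositeADMM.subdiff g y →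
          CompositeADMM.IsADMMStep C f g A β y lam x' y' lam' → x' ∈ X →
          ∀ lstar : CompositeADMM.Vec m,
            CompositeADMM.IsSaddleRel (CompositeADMM.redLag C f g A β₀) X Λ xbar lstar →
            ∀ θ ∈ Set.Icc (0 : ℝ) 1,
              ∃ r s : ℝ,
                CompositeADMM.redLag C f g A β₀ x' lstar = (r : EReal) ∧
                CompositeADMM.redLag C f g A β₀ xbar lstar = (s : EReal) ∧
                r - s + (θ * β - β₀) / 2 * ⟪A (x' - xbar), P (A (x' - xbar))⟫_ℝ
                  ≤ β / 2 * (‖y - A xbar‖ ^ 2 - ‖y' - A xbar‖ ^ 2)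
                    + 1 / (2 * β) * (‖lam - lstar‖ ^ 2 - ‖lam' - lstar‖ ^ 2)
                    - β / 2 * ‖y' - y‖ ^ 2
                    - ((1 - θ) * β - β₀) / (2 * β ^ 2) * ‖lam' - lam‖ ^ 2 := by
  open CompositeADMM in
  obtain ⟨⟨⟨v, hv, -⟩, hlbar⟩, ⟨O, hO, hxO, hfO⟩, -⟩ := hassum
  have hβpos : 0 < β := hβ₀.trans_le hβ
  have hxC : xbar ∈ C := by
    obtain ⟨z, hz⟩ := hCne
    by_contra hx
    have := hv z
    rw [indicatorFn_of_mem hz, indicatorFn, if_neg hx, EReal.top_add_coe, top_le_iff] at this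
    exact EReal.zero_ne_top this
  have hf2 : ContDiffAt ℝ 2 f xbar := hfO.contDiffAt (hO.mem_nhds hxO)
  have hdiff : ∀ᶠ x in 𝓝 xbar, DifferentiableAt ℝ f x := by
    filter_upwards [hf2.eventually (by simp)] with x hx using hx.differentiableAt (by norm_num)
  have htan := eventually_le_inner_gradient hf2 hpos
  obtain ⟨ε, hε, hpoly⟩ := Metric.eventually_nhds_iff_ball.1 (hg.eventually_subdiff lbar)
  -- Half of `ε` goes to the primal error and half to `‖lam - lbar‖`; this makes `X` depend on `β`.
  have hsmall : ∀ᶠ x in 𝓝 xbar, β * ‖A x - A xbar‖ < ε / 2 := by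
    have hc : Continuous fun x => β * ‖A x - A xbar‖ := by fun_prop
    exact hc.continuousAt.eventually_lt continuousAt_const (by simpa using hε)
  intro U hU W hW
  refine ⟨_, inter_mem hU (hdiff.and (htan.and hsmall)), inter_subset_left,
    _, inter_mem hW (Metric.ball_mem_nhds lbar (half_pos hε)), inter_subset_left, ?_⟩
  rintro y lam x' y' lam' hgy hlamΛ hlam ⟨hxup, hyup, rfl⟩ ⟨hx'U, hx'd, hx't, hx's⟩ lstar
    ⟨-, -, hsad⟩ θ ⟨hθ0, -⟩
  obtain ⟨gbar, hgbar⟩ := hg.exists_coe (subdiff_ne_top hlbar hgy)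
  obtain ⟨gy, hgy⟩ := hg.exists_coe hgy
  obtain ⟨hgy', hlam'⟩ := hyup.mem_subdiff hg ⟨y, by rw [hgy]; exact EReal.coe_ne_top _⟩
  obtain ⟨gy', hgy'⟩ := hg.exists_coe hgy'
  have hlow : ((f xbar + gbar : ℝ) : EReal) ≤ redLag C f g A β₀ xbar lstar := by
    refine le_trans ?_ (hsad xbar (mem_of_mem_nhds (inter_mem hU (hdiff.and (htan.and hsmall))))
      lbar (mem_of_mem_nhds (inter_mem hW (Metric.ball_mem_nhds lbar (half_pos hε)))))
    simpa using le_redLag (C := C) (f := f) (A := A) hg hβ₀.le hxC hgbar hlbar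
  have hstar := mem_subdiff_of_le_redLag hg hxC hgbar hlow
  have hs : redLag C f g A β₀ xbar lstar = ((f xbar + gbar : ℝ) : EReal) :=
    le_antisymm (by simpa using redLag_le (f := f) (A := A) hxC hgbar β₀ lstar) hlow
  have hup := redLag_le (f := f) (A := A) hxup.1 hgy' β₀ lstar
  have hbot := le_redLag (f := f) (A := A) hg hβ₀.le hxup.1 hgbar hstar
  obtain ⟨r, hr⟩ : ∃ r : ℝ, redLag C f g A β₀ x' lstar = r :=
    ⟨_, (EReal.coe_toReal (ne_top_of_le_ne_top (EReal.coe_ne_top _) hup)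
      (ne_bot_of_le_ne_bot (EReal.coe_ne_bot _) hbot)).symm⟩
  rw [hr, EReal.coe_le_coe_iff] at hup
  refine ⟨r, _, hr, hs, ?_⟩
  -- the new multiplier is close to `lbar`, hence `y' - A xbar ∈ S`
  have hclose : lam + β • (A x' - y') ∈ Metric.ball lbar ε := by
    rw [mem_ball_iff_norm]
    have h1 := norm_multiplier_sub_le hg hβpos.le hgy' hgbar hlam' hlbar
    have h2 := mem_ball_iff_norm.1 hlamΛ.2
    linarith
  have hPS : P (y' - A xbar) = 0 := by
    rw [hP]
    exact normalProj_eq_zero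
      (sub_mem_tangentSet hg hgbar hgy' hlbar (hpoly _ hclose y' gy' hgy' hlam'))
  have hq : ⟪A (x' - xbar), P (A (x' - xbar))⟫_ℝ ≤ ‖A x' - y'‖ ^ 2 := by
    have h1 : P (A (x' - xbar)) = P (A x' - y') := by
      rw [← sub_eq_zero, ← map_sub, ← hPS, map_sub A]
      congr 1
      abel
    have h2 : ⟪A (x' - xbar), P (A (x' - xbar))⟫_ℝ = ‖P (A (x' - xbar))‖ ^ 2 := by
      rw [hP, inner_normalProj_self]
    rw [h2, h1, hP]
    exact pow_le_pow_left₀ (norm_nonneg _) (norm_normalProj_le _ _ _ _) 2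
  -- the basic inequalities
  have hconv := hx't (AffineSubspace.vsub_mem_direction (subset_affineSpan ℝ C hxup.1)
    (subset_affineSpan ℝ C hxC))
  simp only [smul_apply, ContinuousLinearMap.comp_apply, inner_smul_right,
    ContinuousLinearMap.adjoint_inner_right] at hconv
  have hvar := hxup.inner_nonneg hC hx'd hxC
  have hsub := (mem_subdiff_iff hg hgy').1 hlam' _ _ hgbar
  -- As `lam' - lam = β • (A x' - y')`, this disposes of the cross term between `A x' - y'` and `y'
  -- - y`.
  have hmono := subdiff_monotone hg hgy' hgy hlam' hlam
  set q := ⟪A (x' - xbar), P (A (x' - xbar))⟫_ℝ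
  set d := A x' - y' with hd
  have e1 : ‖lam + β • d - lam‖ ^ 2 = β ^ 2 * ‖d‖ ^ 2 := by
    rw [add_sub_cancel_left, norm_smul, mul_pow, Real.norm_eq_abs, sq_abs]
  have e2 : ‖lam + β • d - lstar‖ ^ 2
      = ‖lam - lstar‖ ^ 2 + 2 * (β * ⟪lam - lstar, d⟫_ℝ) + β ^ 2 * ‖d‖ ^ 2 := by
    rw [show lam + β • d - lstar = (lam - lstar) + β • d by abel, norm_add_sq_real,
      inner_smul_right, norm_smul, mul_pow, Real.norm_eq_abs, sq_abs]
  have e3 : ‖y - A xbar‖ ^ 2 = ‖y' - A xbar‖ ^ 2 - 2 * ⟪y' - A xbar, y' - y⟫_ℝ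
      + ‖y' - y‖ ^ 2 := by
    rw [← norm_sub_sq_real]
    congr 2
    abel
  have hAx : A (xbar - x') = -(d + (y' - A xbar)) := by
    rw [map_sub, hd]
    abel
  have hg1 : ⟪gradient f x', xbar - x'⟫_ℝ = -⟪gradient f x', x' - xbar⟫_ℝ := by
    rw [← inner_neg_right, neg_sub]
  have hAy : A x' - y = d + (y' - y) := by rw [hd]; abel
  have hyA : A xbar - y' = -(y' - A xbar) := by abel
  have hlm : lam + β • d - lam = β • d := by abel
  rw [hg1, hAx, hAy] at hvar
  rw [hyA] at hsub
  rw [hlm] at hmono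
  rw [e1, e2, e3]
  set u := y' - A xbar
  set w := y' - y
  have hmain : r - (f xbar + gbar) ≤ β₀ / 2 * q - ⟪lam - lstar, d⟫_ℝ - β * ‖d‖ ^ 2
      - β * ⟪u, w⟫_ℝ + β₀ / 2 * ‖d‖ ^ 2 := by
    have e6 := real_inner_comm u w
    have e7 := real_inner_comm d w
    simp only [smul_add, inner_add_left, inner_add_right, inner_neg_right, inner_smul_left,
      conj_trivial, inner_sub_left, real_inner_self_eq_norm_sq, e6, e7] at hvar hsub hmono ⊢
    linarith
  -- The `β₀ * q` terms cancel against the left side of the goal, leaving `(θ * β / 2) * q`, which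
  -- `hq` absorbs.
  have hθ := mul_le_mul_of_nonneg_left hq (mul_nonneg hθ0 hβpos.le)
  have e4 : 1 / (2 * β) * (‖lam - lstar‖ ^ 2
      - (‖lam - lstar‖ ^ 2 + 2 * (β * ⟪lam - lstar, d⟫_ℝ) + β ^ 2 * ‖d‖ ^ 2))
      = -⟪lam - lstar, d⟫_ℝ - β / 2 * ‖d‖ ^ 2 := by
    field_simp
    ring
  have e5 : ((1 - θ) * β - β₀) / (2 * β ^ 2) * (β ^ 2 * ‖d‖ ^ 2)
      = ((1 - θ) * β - β₀) / 2 * ‖d‖ ^ 2 := by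
    field_simp
  rw [e4, e5]
  linarith
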